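/- Let $k$ be a field, let $d,r\ge 0$ and $n\ge 1$ be integers, and let $g\in A=k[x_1,\dots,x_d]$ be a weighted homogeneous polynomial, i.e. a homogeneous element for some $\mathbb N$-grading on $A$ with $A_0=k$; no condition is imposed relating its degree to $n$. Suppose that $g=h_1\cdots h_r$ with each $h_i\in k[x_1,\dots,x_d]$ irreducible, and that the ring \[ R=k[z,x_0,x_1,\dots,x_d]/(z^n-x_0g) \] is normal (a domain that is integrally closed in its fraction field; with the other hypotheses $R$ is automatically a domain). Let $\operatorname{Cl}(R)$ denote its divisor class group, i.e. the free abelian group on the height one primes of $R$ modulo the divisors of nonzero elements of the fraction field. Then \[ \operatorname{Cl}(R)\cong(\mathbb Z/n\mathbb Z)^r . \] Moreover each ideal $(z,h_i)$ of $R$, $1\le i\le r$, is a prime ideal of height one, the classes of $(z,h_1),\dots,(z,h_r)$ generate $\operatorname{Cl}(R)$, and, if $n\ge 2$, they form a minimal generating set: no proper subfamily generates $\operatorname{Cl}(R)$. -/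

import Mathlib

/-- A polynomial `g` in `A = k[x_1,…,x_d]` is weighted homogeneous if there is an `ℕ`-grading on
the `k`-algebra `A`, with `A_0 = k`, for which `g` is a homogeneous element.
(`1 : Submodule k A` is the image of `k` in `A`.) -/
def IsWeightedHomogeneousPoly {k : Type*} [Field k] {d : ℕ} (g : MvPolynomial (Fin d) k) : Prop :=
  ∃ (𝒜 : ℕ → Submodule k (MvPolynomial (Fin d) k)) (_ : GradedAlgebra 𝒜),
    𝒜 0 = 1 ∧ ∃ m : ℕ, g ∈ 𝒜 m

/-- The prime ideals of height one of a commutative ring. -/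
structure HeightOnePrime (R : Type*) [CommRing R] where
  asIdeal : Ideal R
  isPrime : asIdeal.IsPrime
  height_eq_one : asIdeal.height = 1

/-- The order of `a ∈ R` along a height one prime `p`: the length of `R_p / a R_p`.
When `R_p` is a discrete valuation ring this is the normalized valuation of `a`. -/
noncomputable def HeightOnePrime.ord {R : Type*} [CommRing R] (p : HeightOnePrime R) (a : R) : ℕ∞ :=
  haveI := p.isPrime
  Ring.ord (Localization.AtPrime p.asIdeal) (algebraMap R (Localization.AtPrime p.asIdeal) a)

/-- Weil divisors on `Spec R`: the free abelian group on the height one primes of `R`. -/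
abbrev WeilDivisor (R : Type*) [CommRing R] : Type _ := HeightOnePrime R →₀ ℤ

/-- `D` is the divisor of a fraction `a / b`, with `a` and `b` nonzerodivisors of `R`. -/
def WeilDivisor.IsDivOfFraction {R : Type*} [CommRing R] (D : WeilDivisor R) : Prop :=
  ∃ a ∈ nonZeroDivisors R, ∃ b ∈ nonZeroDivisors R,
    ∀ p : HeightOnePrime R, D p = ((p.ord a).toNat : ℤ) - ((p.ord b).toNat : ℤ)

/-- The group of principal divisors. (For a Noetherian domain the divisors of fractions already
form a subgroup, and every nonzero fraction has a divisor.) -/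
noncomputable def principalDivisors (R : Type*) [CommRing R] : AddSubgroup (WeilDivisor R) :=
  AddSubgroup.closure {D | D.IsDivOfFraction}

/-- The divisor class group `Cl(R)` of a Noetherian normal domain `R`: Weil divisors modulo
principal divisors. -/
abbrev DivisorClassGroup (R : Type*) [CommRing R] : Type _ :=
  WeilDivisor R ⧸ principalDivisors R

/-- The class in `Cl(R)` of a height one prime. -/
noncomputable def HeightOnePrime.divisorClass {R : Type*} [CommRing R] (p : HeightOnePrime R) :
    DivisorClassGroup R :=
  QuotientAddGroup.mk (Finsupp.single p 1)

/-- The ring `k[z,x_0,…,x_d]/(z^n - x_0 g)`, where `g` is a polynomial in `x_1,…,x_d`, as the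
quotient of `k[x_0,…,x_d][z]`. The variable `x_0` is `X 0`, and `x_i` is `X i` for `i ≥ 1`, so that
`g` becomes a polynomial in `x_0,…,x_d` through `Fin.succ`. -/
abbrev CyclicHypersurface {k : Type*} [Field k] {d : ℕ} (n : ℕ) (g : MvPolynomial (Fin d) k) :
    Type _ :=
  AdjoinRoot ((Polynomial.X : Polynomial (MvPolynomial (Fin (d + 1)) k)) ^ n -
    Polynomial.C (MvPolynomial.X 0 * MvPolynomial.rename Fin.succ g))

namespace CyclicHypersurface

/-- The image of the variable `z` in `k[z,x_0,…,x_d]/(z^n - x_0 g)`. -/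
noncomputable def z {k : Type*} [Field k] {d : ℕ} (n : ℕ) (g : MvPolynomial (Fin d) k) :
    CyclicHypersurface n g :=
  AdjoinRoot.root _

/-- The image of a polynomial `h` in `x_1,…,x_d` in `k[z,x_0,…,x_d]/(z^n - x_0 g)`. -/
noncomputable def ofPoly {k : Type*} [Field k] {d : ℕ} (n : ℕ) (g h : MvPolynomial (Fin d) k) :
    CyclicHypersurface n g :=
  AdjoinRoot.of _ (MvPolynomial.rename Fin.succ h)

end CyclicHypersurface

/-! Nagata's argument. Put `B = k[x_1,…,x_d][z]`, a factorial ring. In `R` one has `x_0 g = z^n`, so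
`x_0` is superfluous once `g` is inverted, and `R[1/g] = B[1/g]` (`isIsoAway_incl`). A height one
prime avoiding `g` therefore comes from a prime element of `B`, and is principal up to primes
containing `g`. The latter are exactly the `p_i = (z, h_i)`, because `h_i ∈ q` forces `z^n ∈ q`.
Hence the classes of the `p_i` generate.

For the relations, let `n ≥ 2`. Normality makes `g` squarefree, since `h² ∣ g` would make
`z^(n-1)/h` integral over `R`. Locally at `p_i` the element `z` is then a uniformizer and `h_i` is a
unit times `z^n`, so `div h_i = n p_i` and `n` kills each class. Conversely, a fraction whose
divisor is supported on the `p_i` is, up to a unit of `B`, a product of powers of prime factors of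
`g`. Those factors are associates of the `h_l`, so all its orders are multiples of `n`
(`natOrd_modEq`). The relations are thus exactly `(nℤ)^r`.

If `n = 1`, repeated factors may occur, but `h_i` still has order one along `p_i`, so every class
vanishes. -/

/-- In a Noetherian domain, a prime minimal over a nonzero element has height one. -/
theorem Ideal.height_eq_one_of_minimal_over_singleton {R : Type*} [CommRing R] [IsDomain R]
    [IsNoetherianRing R] {p : Ideal R} [p.IsPrime] {x : R} (hx0 : x ≠ 0) (hx : x ∈ p)
    (hmin : ∀ q : Ideal R, q.IsPrime → x ∈ q → q ≤ p → p ≤ q) : p.height = 1 := by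
  refine le_antisymm ?_ ?_
  · refine Ideal.height_le_one_of_isPrincipal_of_mem_minimalPrimes (Ideal.span {x}) p ?_
    refine ⟨⟨‹_›, by simpa [Ideal.span_le] using hx⟩, fun q hq hqp => hmin q hq.1 ?_ hqp⟩
    exact hq.2 (Ideal.mem_span_singleton_self x)
  · rw [Order.one_le_iff_ne_zero, Ne, Ideal.height_eq_zero_iff_eq_bot]
    rintro rfl
    exact hx0 (by simpa using hx)

/-! ### Orders along height one primes -/

namespace HeightOnePrime

variable {R : Type*} [CommRing R]

theorem ext_asIdeal {p q : HeightOnePrime R} (h : p.asIdeal = q.asIdeal) : p = q := by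
  cases p; cases q; congr

/-- The order along a height one prime as a natural number. -/
noncomputable def natOrd (p : HeightOnePrime R) (a : R) : ℕ := (p.ord a).toNat

/-- An element generating `p` locally at `p` has order one along `p`. -/
theorem natOrd_eq_one (p : HeightOnePrime R) {a : R} (ha : a ∈ p.asIdeal)
    (hgen : ∀ b ∈ p.asIdeal, ∃ s ∉ p.asIdeal, a ∣ s * b) : p.natOrd a = 1 := by
  have := p.isPrime
  have hspan : Ideal.span {algebraMap R (Localization.AtPrime p.asIdeal) a} =
      IsLocalRing.maximalIdeal (Localization.AtPrime p.asIdeal) := by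
    rw [← Localization.AtPrime.map_eq_maximalIdeal]
    refine le_antisymm ?_ ?_
    · rw [Ideal.span_singleton_le_iff_mem]
      exact Ideal.mem_map_of_mem _ ha
    · rw [Ideal.map_le_iff_le_comap]
      intro b hb
      obtain ⟨s, hs, c, hc⟩ := hgen b hb
      have hu : IsUnit (algebraMap R (Localization.AtPrime p.asIdeal) s) :=
        (IsLocalization.AtPrime.isUnit_to_map_iff _ p.asIdeal s).mpr hs
      rw [Ideal.mem_comap, Ideal.mem_span_singleton, ← hu.dvd_mul_left, ← map_mul, hc, map_mul]
      exact dvd_mul_right _ _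
  have h : p.ord a = 1 := by
    unfold HeightOnePrime.ord
    rw [Ring.ord, hspan, Module.length_eq_one_iff]
    exact isSimpleModule_iff_isCoatom.mpr (Ideal.isMaximal_def.mp inferInstance)
  rw [natOrd, h]
  rfl

variable [IsDomain R]

theorem algebraMap_ne_zero (p : HeightOnePrime R) {a : R} (ha : a ≠ 0) :
    have := p.isPrime
    algebraMap R (Localization.AtPrime p.asIdeal) a ≠ 0 := by
  have := p.isPrime
  have hinj := IsLocalization.injective (Localization.AtPrime p.asIdeal)
    p.asIdeal.primeCompl_le_nonZeroDivisors
  simpa using hinj.ne ha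

theorem asIdeal_ne_bot (p : HeightOnePrime R) : p.asIdeal ≠ ⊥ := by
  intro h
  have := p.height_eq_one
  rw [h, Ideal.height_bot] at this
  simp at this

/-- Distinct height one primes are incomparable. -/
theorem eq_of_le (p : HeightOnePrime R) {I : Ideal R} (hI : I.IsPrime) (hI0 : I ≠ ⊥)
    (hle : I ≤ p.asIdeal) : I = p.asIdeal := by
  by_contra hne
  have := p.isPrime
  have hlt : I < p.asIdeal := lt_of_le_of_ne hle hne
  have h1 := Ideal.height_add_one_le_of_lt_of_isPrime hlt
  rw [p.height_eq_one] at h1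
  have h2 : I.height ≠ 0 := by rwa [Ne, Ideal.height_eq_zero_iff_eq_bot]
  have h3 : (1 : ℕ∞) ≤ I.height := Order.one_le_iff_ne_zero.mpr h2
  have h4 : (1 : ℕ∞) + 1 ≤ 1 := (add_le_add_left h3 1).trans h1
  norm_num at h4

variable [IsNoetherianRing R]

/-- The localization is Noetherian of dimension at most one, so the quotient by a nonzero element
has finite length. Thus `natOrd` loses nothing away from `0`, where `toNat` would send `⊤` to `0`.
-/
theorem ord_ne_top (p : HeightOnePrime R) {a : R} (ha : a ≠ 0) : p.ord a ≠ ⊤ := by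
  have := p.isPrime
  have : Ring.KrullDimLE 1 (Localization.AtPrime p.asIdeal) := by
    rw [Ring.KrullDimLE, Order.krullDimLE_iff]
    have := IsLocalization.AtPrime.ringKrullDim_eq_height p.asIdeal
      (Localization.AtPrime p.asIdeal)
    rw [p.height_eq_one] at this
    exact this.le
  have : IsNoetherianRing (Localization.AtPrime p.asIdeal) :=
    IsLocalization.isNoetherianRing p.asIdeal.primeCompl _ inferInstance
  exact Ring.ord_ne_top (mem_nonZeroDivisors_of_ne_zero (p.algebraMap_ne_zero ha))

theorem natOrd_mul (p : HeightOnePrime R) {a b : R} (ha : a ≠ 0) (hb : b ≠ 0) :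
    p.natOrd (a * b) = p.natOrd a + p.natOrd b := by
  have := p.isPrime
  have h : p.ord (a * b) = p.ord a + p.ord b := by
    unfold HeightOnePrime.ord
    rw [map_mul, Ring.ord_mul _ (mem_nonZeroDivisors_of_ne_zero (p.algebraMap_ne_zero hb))]
  rw [natOrd, h, ENat.toNat_add (p.ord_ne_top ha) (p.ord_ne_top hb)]
  rfl

theorem natOrd_eq_zero_iff (p : HeightOnePrime R) {a : R} (ha : a ≠ 0) :
    p.natOrd a = 0 ↔ a ∉ p.asIdeal := by
  have := p.isPrime
  rw [natOrd, ENat.toNat_eq_zero, or_iff_left (p.ord_ne_top ha)]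
  unfold HeightOnePrime.ord
  rw [Ring.ord, Module.length_eq_zero_iff, Submodule.Quotient.subsingleton_iff,
    Ideal.span_singleton_eq_top, IsLocalization.AtPrime.isUnit_to_map_iff _ p.asIdeal]
  rfl

theorem natOrd_pow (p : HeightOnePrime R) {a : R} (ha : a ≠ 0) (n : ℕ) :
    p.natOrd (a ^ n) = n * p.natOrd a := by
  induction n with
  | zero =>
    rw [pow_zero, zero_mul, p.natOrd_eq_zero_iff one_ne_zero]
    exact fun h => p.isPrime.ne_top ((Ideal.eq_top_iff_one _).mpr h)
  | succ n ih => rw [pow_succ, p.natOrd_mul (pow_ne_zero n ha) ha, ih]; ring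

end HeightOnePrime

/-! ### Comparison with a factorial ring after inverting one element -/

/-- An injective ring homomorphism `j : B → R` that becomes an isomorphism after inverting `g`. -/
structure IsIsoAway {B R : Type*} [CommRing B] [CommRing R] (j : B →+* R) (g : B) : Prop where
  injective : Function.Injective j
  exists_pow_mul_eq : ∀ a : R, ∃ (N : ℕ) (b : B), j g ^ N * a = j b

/-- The contraction to `R` of the ideal generated by `f` after inverting `g`. -/
def awaySpan {B R : Type*} [CommRing B] [CommRing R] {j : B →+* R} {g : B} (hj : IsIsoAway j g)
    (f : B) : Ideal R where
  carrier := {a | ∃ (N : ℕ) (b : B), j g ^ N * a = j (f * b)}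
  zero_mem' := ⟨0, 0, by simp⟩
  add_mem' := by
    rintro a a' ⟨N, b, h⟩ ⟨N', b', h'⟩
    refine ⟨N + N', g ^ N' * b + g ^ N * b', ?_⟩
    simp only [map_mul, map_add, map_pow] at h h' ⊢
    linear_combination j g ^ N' * h + j g ^ N * h'
  smul_mem' := by
    rintro c a ⟨N, b, h⟩
    obtain ⟨M, e, he⟩ := hj.exists_pow_mul_eq c
    refine ⟨N + M, b * e, ?_⟩
    simp only [map_mul, smul_eq_mul] at h he ⊢
    linear_combination j g ^ M * c * h + j f * j b * he

namespace IsIsoAway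

variable {B R : Type*} [CommRing B] [CommRing R] {j : B →+* R} {g : B}

theorem map_ne_zero (hj : IsIsoAway j g) {b : B} (hb : b ≠ 0) : j b ≠ 0 := by
  simpa using hj.injective.ne hb

theorem map_mem_awaySpan_self (hj : IsIsoAway j g) (f : B) : j f ∈ awaySpan hj f :=
  ⟨0, 1, by simp⟩

theorem map_mem_awaySpan_iff (hj : IsIsoAway j g) {f : B} (hf : Prime f) (hfg : ¬ f ∣ g) {b : B} :
    j b ∈ awaySpan hj f ↔ f ∣ b := by
  refine ⟨?_, ?_⟩
  · rintro ⟨N, c, h⟩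
    rw [← map_pow, ← map_mul] at h
    have h' : f ∣ g ^ N * b := ⟨c, hj.injective h⟩
    exact (hf.dvd_or_dvd h').resolve_left fun h => hfg (hf.dvd_of_dvd_pow h)
  · rintro ⟨c, rfl⟩
    exact ⟨0, c, by simp⟩

/-- Clearing powers of `g` replaces both factors by elements of `B`, where `f` is prime. -/
theorem awaySpan_isPrime (hj : IsIsoAway j g) {f : B} (hf : Prime f) (hfg : ¬ f ∣ g) :
    (awaySpan hj f).IsPrime := by
  refine ⟨?_, ?_⟩
  · rw [Ne, Ideal.eq_top_iff_one, ← map_one j, hj.map_mem_awaySpan_iff hf hfg]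
    exact hf.not_dvd_one
  · intro a a' haa
    obtain ⟨N, b, h⟩ := hj.exists_pow_mul_eq a
    obtain ⟨N', b', h'⟩ := hj.exists_pow_mul_eq a'
    have hbb : j (b * b') ∈ awaySpan hj f := by
      have : j (b * b') = (j g ^ N * j g ^ N') * (a * a') := by
        rw [map_mul]; linear_combination - j g ^ N' * a' * h - j b * h'
      rw [this]
      exact Ideal.mul_mem_left _ _ haa
    rw [hj.map_mem_awaySpan_iff hf hfg] at hbb
    refine (hf.dvd_or_dvd hbb).imp ?_ ?_
    · rintro ⟨c, rfl⟩
      exact ⟨N, c, h⟩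
    · rintro ⟨c, rfl⟩
      exact ⟨N', c, h'⟩

theorem awaySpan_le (hj : IsIsoAway j g) {f : B} {q : Ideal R} (hq : q.IsPrime) (hfq : j f ∈ q)
    (hgq : j g ∉ q) : awaySpan hj f ≤ q := by
  rintro a ⟨N, b, h⟩
  have : j g ^ N * a ∈ q := by
    rw [h, map_mul]
    exact Ideal.mul_mem_right _ _ hfq
  exact (hq.mem_or_mem this).resolve_left fun h => hgq (hq.mem_of_pow_mem N h)

theorem natOrd_map_eq_one (hj : IsIsoAway j g) {f : B} (hf : Prime f) (hfg : ¬ f ∣ g)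
    {q : HeightOnePrime R} (hq : q.asIdeal = awaySpan hj f) : q.natOrd (j f) = 1 := by
  refine q.natOrd_eq_one (hq ▸ hj.map_mem_awaySpan_self f) fun a ha => ?_
  rw [hq] at ha ⊢
  obtain ⟨N, b, h⟩ := ha
  refine ⟨j g ^ N, ?_, j b, by rw [h, map_mul]⟩
  rw [← map_pow, hj.map_mem_awaySpan_iff hf hfg]
  exact fun h => hfg (hf.dvd_of_dvd_pow h)

variable [IsDomain R]

/-- A prime inside `awaySpan hj f` that contains `f` cannot contain `g`, as `f ∤ g`; hence it
contains all of `awaySpan hj f`. -/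
theorem exists_heightOnePrime [IsNoetherianRing R] (hj : IsIsoAway j g) {f : B} (hf : Prime f)
    (hfg : ¬ f ∣ g) : ∃ q : HeightOnePrime R, q.asIdeal = awaySpan hj f := by
  have hp := hj.awaySpan_isPrime hf hfg
  refine ⟨⟨awaySpan hj f, hp, ?_⟩, rfl⟩
  refine Ideal.height_eq_one_of_minimal_over_singleton (hj.map_ne_zero hf.ne_zero)
    (hj.map_mem_awaySpan_self f) fun q hq hfq hle => hj.awaySpan_le hq hfq fun hgq => ?_
  exact hfg ((hj.map_mem_awaySpan_iff hf hfg).mp (hle hgq))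

theorem natOrd_map_of_isUnit [IsNoetherianRing R] (q : HeightOnePrime R) {b : B} (hb : IsUnit b) :
    q.natOrd (j b) = 0 := by
  rw [q.natOrd_eq_zero_iff (hb.map j).ne_zero]
  exact fun h => q.isPrime.ne_top (Ideal.eq_top_of_isUnit_mem _ h (hb.map j))

variable [UniqueFactorizationMonoid B]

/-- The contraction of `q` to the factorial ring `B` is a nonzero prime, so it contains a prime
element `f`. The nonzero prime cut out by `f` lies in `q`, and height one forces equality. -/
theorem exists_prime_of_notMem (hj : IsIsoAway j g) (q : HeightOnePrime R)
    (hgq : j g ∉ q.asIdeal) :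
    ∃ f : B, Prime f ∧ ¬ f ∣ g ∧ q.asIdeal = awaySpan hj f := by
  have hq := q.isPrime
  have hg0 : j g ≠ 0 := fun h => hgq (h ▸ zero_mem _)
  obtain ⟨a, haq, ha0⟩ := (Submodule.ne_bot_iff _).mp q.asIdeal_ne_bot
  obtain ⟨N, b, h⟩ := hj.exists_pow_mul_eq a
  have hcomap : Ideal.comap j q.asIdeal ≠ ⊥ := by
    refine (Submodule.ne_bot_iff _).mpr ⟨b, ?_, ?_⟩
    · rw [Ideal.mem_comap, ← h]
      exact Ideal.mul_mem_left _ _ haq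
    · rintro rfl
      rw [map_zero] at h
      exact mul_ne_zero (pow_ne_zero N hg0) ha0 h
  obtain ⟨f, hfq, hf⟩ := Ideal.IsPrime.exists_mem_prime_of_ne_bot
    (Ideal.comap_isPrime j q.asIdeal) hcomap
  have hfg : ¬ f ∣ g := by
    rintro ⟨c, rfl⟩
    exact hgq (by rw [map_mul]; exact Ideal.mul_mem_right _ _ hfq)
  refine ⟨f, hf, hfg, (q.eq_of_le (hj.awaySpan_isPrime hf hfg) ?_ (hj.awaySpan_le hq hfq hgq)).symm⟩
  exact (Submodule.ne_bot_iff _).mpr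
    ⟨j f, hj.map_mem_awaySpan_self f, hj.map_ne_zero hf.ne_zero⟩

/-- A height one prime not containing `g` is cut out by an element whose divisor is that prime up
to primes containing `g`. -/
theorem exists_natOrd_eq [IsNoetherianRing R] (hj : IsIsoAway j g) (q : HeightOnePrime R)
    (hgq : j g ∉ q.asIdeal) :
    ∃ a : R, a ≠ 0 ∧ q.natOrd a = 1 ∧
      ∀ q' : HeightOnePrime R, j g ∉ q'.asIdeal → q' ≠ q → q'.natOrd a = 0 := by
  obtain ⟨f, hf, hfg, hq⟩ := hj.exists_prime_of_notMem q hgq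
  refine ⟨j f, hj.map_ne_zero hf.ne_zero, hj.natOrd_map_eq_one hf hfg hq, fun q' hgq' hne => ?_⟩
  rw [q'.natOrd_eq_zero_iff (hj.map_ne_zero hf.ne_zero)]
  intro hfq'
  refine hne (HeightOnePrime.ext_asIdeal ?_)
  have hle : q.asIdeal ≤ q'.asIdeal := hq ▸ hj.awaySpan_le q'.isPrime hfq' hgq'
  exact (q'.eq_of_le q.isPrime q.asIdeal_ne_bot hle).symm

/-- If two elements have the same order along every height one prime away from `g`, then their
orders along `p` are congruent modulo any `n` that divides the order of every prime factor
of `g`. -/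
theorem natOrd_map_modEq [IsNoetherianRing R] (hj : IsIsoAway j g) (p : HeightOnePrime R) (n : ℕ)
    (hp : ∀ f : B, Prime f → f ∣ g → n ∣ p.natOrd (j f)) (α : B) :
    ∀ β : B, α ≠ 0 → β ≠ 0 →
      (∀ q : HeightOnePrime R, j g ∉ q.asIdeal → q.natOrd (j α) = q.natOrd (j β)) →
      p.natOrd (j α) ≡ p.natOrd (j β) [MOD n] := by
  have hmul : ∀ (q : HeightOnePrime R) {a b : B}, a ≠ 0 → b ≠ 0 →
      q.natOrd (j (a * b)) = q.natOrd (j a) + q.natOrd (j b) := fun q a b ha hb => by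
    rw [map_mul, q.natOrd_mul (hj.map_ne_zero ha) (hj.map_ne_zero hb)]
  have hzero : ∀ (q : HeightOnePrime R), j g ∉ q.asIdeal → ∀ {f : B}, Prime f → f ∣ g →
      q.natOrd (j f) = 0 := by
    rintro q hgq f hf ⟨c, rfl⟩
    rw [q.natOrd_eq_zero_iff (hj.map_ne_zero hf.ne_zero)]
    exact fun h => hgq (by rw [map_mul]; exact Ideal.mul_mem_right _ _ h)
  -- Strip prime factors from `α` and `β`. One dividing `g` changes the order along `p` by a
  -- multiple of `n` and no order away from `g`. One not dividing `g` has its own height one prime,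
  -- where equality of orders forces it into the other element too, and it cancels.
  induction α using UniqueFactorizationMonoid.induction_on_prime with
  | h₁ => exact fun β h => absurd rfl h
  | h₂ α hα =>
    intro β
    induction β using UniqueFactorizationMonoid.induction_on_prime with
    | h₁ => exact fun _ h => absurd rfl h
    | h₂ β hβ =>
      intros
      rw [natOrd_map_of_isUnit p hα, natOrd_map_of_isUnit p hβ]
    | h₃ β f hβ hf ih =>
      intro hα0 _ hq
      by_cases hfg : f ∣ g
      · rw [hmul p hf.ne_zero hβ]
        refine (ih hα0 hβ fun q hgq => ?_).trans ?_
        · rw [hq q hgq, hmul q hf.ne_zero hβ, hzero q hgq hf hfg, zero_add]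
        · have := (Nat.modEq_zero_iff_dvd.mpr (hp f hf hfg)).symm.add_right (p.natOrd (j β))
          simpa using this
      · exfalso
        obtain ⟨q, hqf⟩ := hj.exists_heightOnePrime hf hfg
        have hgq : j g ∉ q.asIdeal := by rwa [hqf, hj.map_mem_awaySpan_iff hf hfg]
        have := hq q hgq
        rw [natOrd_map_of_isUnit q hα, hmul q hf.ne_zero hβ,
          hj.natOrd_map_eq_one hf hfg hqf] at this
        omega
  | h₃ α f hα hf ih =>
    intro β _ hβ hq
    by_cases hfg : f ∣ g
    · rw [hmul p hf.ne_zero hα]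
      refine Nat.ModEq.trans ?_ (ih β hα hβ fun q hgq => ?_)
      · have := (Nat.modEq_zero_iff_dvd.mpr (hp f hf hfg)).add_right (p.natOrd (j α))
        simpa using this
      · rw [← hq q hgq, hmul q hf.ne_zero hα, hzero q hgq hf hfg, zero_add]
    · have hdvd : f ∣ β := by
        obtain ⟨q, hqf⟩ := hj.exists_heightOnePrime hf hfg
        have hgq : j g ∉ q.asIdeal := by rwa [hqf, hj.map_mem_awaySpan_iff hf hfg]
        have := hq q hgq
        rw [hmul q hf.ne_zero hα, hj.natOrd_map_eq_one hf hfg hqf] at this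
        rw [← hj.map_mem_awaySpan_iff hf hfg, ← hqf]
        by_contra hmem
        rw [← q.natOrd_eq_zero_iff (hj.map_ne_zero hβ)] at hmem
        omega
      obtain ⟨β, rfl⟩ := hdvd
      have hβ0 : β ≠ 0 := right_ne_zero_of_mul hβ
      rw [hmul p hf.ne_zero hα, hmul p hf.ne_zero hβ0]
      refine (ih β hα hβ0 fun q hgq => ?_).add_left _
      have := hq q hgq
      rw [hmul q hf.ne_zero hα, hmul q hf.ne_zero hβ0] at this
      omega

/-- Multiplying both elements by the same power of `g` moves them into `B` and shifts their orders
equally. -/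
theorem natOrd_modEq [IsNoetherianRing R] (hj : IsIsoAway j g) (hg : g ≠ 0)
    (p : HeightOnePrime R) (n : ℕ) (hp : ∀ f : B, Prime f → f ∣ g → n ∣ p.natOrd (j f))
    {a b : R} (ha : a ≠ 0) (hb : b ≠ 0)
    (hab : ∀ q : HeightOnePrime R, j g ∉ q.asIdeal → q.natOrd a = q.natOrd b) :
    p.natOrd a ≡ p.natOrd b [MOD n] := by
  obtain ⟨N, α, hα⟩ := hj.exists_pow_mul_eq a
  obtain ⟨M, β, hβ⟩ := hj.exists_pow_mul_eq b
  have hc : j g ^ (N + M) ≠ 0 := pow_ne_zero _ (hj.map_ne_zero hg)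
  have hα' : j (g ^ M * α) = j g ^ (N + M) * a := by
    rw [map_mul, map_pow, ← hα]; ring
  have hβ' : j (g ^ N * β) = j g ^ (N + M) * b := by
    rw [map_mul, map_pow, ← hβ]; ring
  have hα0 : g ^ M * α ≠ 0 := by
    intro h
    rw [h, map_zero] at hα'
    exact mul_ne_zero hc ha hα'.symm
  have hβ0 : g ^ N * β ≠ 0 := by
    intro h
    rw [h, map_zero] at hβ'
    exact mul_ne_zero hc hb hβ'.symm
  have key := hj.natOrd_map_modEq p n hp _ _ hα0 hβ0 fun q hgq => by
    rw [hα', hβ', q.natOrd_mul hc ha, q.natOrd_mul hc hb, hab q hgq]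
  rw [hα', hβ', p.natOrd_mul hc ha, p.natOrd_mul hc hb] at key
  exact Nat.ModEq.add_left_cancel' _ key

end IsIsoAway

/-! ### Weil divisors and principal divisors -/

namespace WeilDivisor

variable {R : Type*} [CommRing R]

theorem mk_mem_of_divisorClass_mem (H : AddSubgroup (DivisorClassGroup R)) (D : WeilDivisor R)
    (h : ∀ q ∈ D.support, q.divisorClass ∈ H) :
    (QuotientAddGroup.mk D : DivisorClassGroup R) ∈ H := by
  have : (QuotientAddGroup.mk D : DivisorClassGroup R) =
      ∑ q ∈ D.support, D q • q.divisorClass := by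
    conv_lhs => rw [← Finsupp.sum_single D, Finsupp.sum]
    rw [← QuotientAddGroup.mk'_apply, map_sum]
    refine Finset.sum_congr rfl fun q _ => ?_
    rw [HeightOnePrime.divisorClass, ← QuotientAddGroup.mk'_apply, ← map_zsmul]
    simp
  rw [this]
  exact AddSubgroup.sum_mem _ fun q hq => AddSubgroup.zsmul_mem _ (h q hq) _

variable [IsDomain R] [IsNoetherianRing R]

/-- The principal divisors of a Noetherian domain are the divisors of fractions. -/
theorem isDivOfFraction_of_mem_principalDivisors {D : WeilDivisor R}
    (hD : D ∈ principalDivisors R) : D.IsDivOfFraction := by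
  have h0 : ∀ {a : R}, a ∈ nonZeroDivisors R → a ≠ 0 := fun h => nonZeroDivisors.ne_zero h
  induction hD using AddSubgroup.closure_induction with
  | mem D hD => exact hD
  | zero => exact ⟨1, one_mem _, 1, one_mem _, by simp⟩
  | add D E _ _ hD hE =>
    obtain ⟨a, ha, b, hb, h⟩ := hD
    obtain ⟨a', ha', b', hb', h'⟩ := hE
    refine ⟨a * a', mul_mem ha ha', b * b', mul_mem hb hb', fun p => ?_⟩
    have h1 := p.natOrd_mul (h0 ha) (h0 ha')
    have h2 := p.natOrd_mul (h0 hb) (h0 hb')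
    simp only [HeightOnePrime.natOrd] at h1 h2
    rw [Finsupp.add_apply, h, h', h1, h2]
    push_cast
    ring
  | neg D _ hD =>
    obtain ⟨a, ha, b, hb, h⟩ := hD
    exact ⟨b, hb, a, ha, fun p => by rw [Finsupp.neg_apply, h]; ring⟩

/-- A divisor whose coefficients are the orders of a nonzero element has trivial class. -/
theorem mk_eq_zero_of_natOrd {D : WeilDivisor R} {a : R} (ha : a ≠ 0)
    (h : ∀ q : HeightOnePrime R, D q = q.natOrd a) :
    (QuotientAddGroup.mk D : DivisorClassGroup R) = 0 := by
  rw [QuotientAddGroup.eq_zero_iff]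
  refine AddSubgroup.subset_closure
    ⟨a, mem_nonZeroDivisors_of_ne_zero ha, 1, one_mem _, fun q => ?_⟩
  have h1 : q.natOrd 1 = 0 := by simpa using q.natOrd_pow ha 0
  rw [h, ← HeightOnePrime.natOrd, ← HeightOnePrime.natOrd, h1]
  simp

end WeilDivisor

/-! ### Generators and relations of the class group -/

section ClassGroup

variable {B R : Type*} [CommRing B] [UniqueFactorizationMonoid B] [CommRing R] [IsDomain R]
  [IsNoetherianRing R] {j : B →+* R} {g : B}

/-- The classes of the primes containing `g` generate the class group. -/
theorem IsIsoAway.closure_divisorClass_eq_top (hj : IsIsoAway j g) {ι : Type*} [Finite ι]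
    (p : ι → HeightOnePrime R)
    (hp : ∀ q : HeightOnePrime R, j g ∈ q.asIdeal → ∃ i, q = p i) :
    AddSubgroup.closure (Set.range fun i => (p i).divisorClass) = ⊤ := by
  set H := AddSubgroup.closure (Set.range fun i => (p i).divisorClass)
  have hmem : ∀ q : HeightOnePrime R, j g ∈ q.asIdeal → q.divisorClass ∈ H := by
    intro q hq
    obtain ⟨i, rfl⟩ := hp q hq
    exact AddSubgroup.subset_closure ⟨i, rfl⟩
  have hall : ∀ q : HeightOnePrime R, q.divisorClass ∈ H := by
    intro q
    by_cases hgq : j g ∈ q.asIdeal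
    · exact hmem q hgq
    obtain ⟨a, ha, haq, ha'⟩ := hj.exists_natOrd_eq q hgq
    -- The order of `a` can be nonzero only at `q` and at the finitely many primes over `g`, so `a`
    -- has a divisor.
    have hfin : (Function.support fun q' : HeightOnePrime R => (q'.natOrd a : ℤ)).Finite := by
      refine ((Set.finite_range p).insert q).subset fun q' hq' => ?_
      by_cases hgq' : j g ∈ q'.asIdeal
      · obtain ⟨i, rfl⟩ := hp q' hgq'
        exact Or.inr ⟨i, rfl⟩
      · left
        by_contra hne
        exact hq' (by simp [ha' q' hgq' hne])
    set D : WeilDivisor R := Finsupp.ofSupportFinite _ hfin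
    have hD : ∀ q' : HeightOnePrime R, D q' = q'.natOrd a := fun _ => rfl
    have hdecomp : Finsupp.single q 1 = D - D.erase q := by
      rw [eq_sub_iff_add_eq, ← Finsupp.single_add_erase q D, hD, haq]
      simp
    have hclass : q.divisorClass = QuotientAddGroup.mk D - QuotientAddGroup.mk (D.erase q) := by
      rw [HeightOnePrime.divisorClass, hdecomp]
      rfl
    rw [hclass, WeilDivisor.mk_eq_zero_of_natOrd ha hD]
    refine AddSubgroup.sub_mem _ (AddSubgroup.zero_mem _)
      (WeilDivisor.mk_mem_of_divisorClass_mem H _ fun q' hq' => ?_)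
    classical
    rw [Finsupp.support_erase, Finset.mem_erase, Finsupp.mem_support_iff, hD] at hq'
    by_contra hq''
    exact hq'.2 (by simp [ha' q' (fun h => hq'' (hmem q' h)) hq'.1])
  rw [AddSubgroup.eq_top_iff']
  intro x
  obtain ⟨D, rfl⟩ := QuotientAddGroup.mk_surjective x
  exact WeilDivisor.mk_mem_of_divisorClass_mem H D fun q _ => hall q

/-- The relations between the classes of the primes containing `g`, provided that the order of
every prime factor of `g` is a multiple of `n`, and that `n` times each of these primes is
principal. -/
theorem IsIsoAway.sum_zsmul_divisorClass_eq_zero_iff (hj : IsIsoAway j g) (hg : g ≠ 0)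
    {ι : Type*} [Fintype ι] (p : ι → HeightOnePrime R) (n : ℕ)
    (hgp : ∀ i, j g ∈ (p i).asIdeal)
    (hdvd : ∀ i, ∀ f : B, Prime f → f ∣ g → n ∣ (p i).natOrd (j f))
    (hnp : ∀ i, ∃ t : R, t ≠ 0 ∧ (p i).natOrd t = n ∧ ∀ q, q ≠ p i → q.natOrd t = 0)
    (hinj : n ≠ 1 → Function.Injective p) (m : ι → ℤ) :
    ∑ i, m i • (p i).divisorClass = 0 ↔ ∀ i, (n : ℤ) ∣ m i := by
  constructor
  · intro hm i
    -- The primes may repeat when `n = 1`, but then the divisibility is trivial.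
    by_cases hn : n = 1
    · simp [hn]
    have hm' : (∑ i, m i • Finsupp.single (p i) 1 : WeilDivisor R) ∈ principalDivisors R := by
      rw [← QuotientAddGroup.eq_zero_iff, ← hm, ← QuotientAddGroup.mk'_apply, map_sum]
      exact Finset.sum_congr rfl fun i _ => map_zsmul _ _ _
    obtain ⟨a, ha, b, hb, h⟩ := WeilDivisor.isDivOfFraction_of_mem_principalDivisors hm'
    replace h : ∀ q : HeightOnePrime R, ∑ i, m i • (Finsupp.single (p i) (1 : ℤ)) q =
        (q.natOrd a : ℤ) - q.natOrd b := fun q => by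
      rw [HeightOnePrime.natOrd, HeightOnePrime.natOrd, ← h q, Finsupp.finsetSum_apply]
      rfl
    -- Every `p i` contains `g`, so `a` and `b` have equal orders at each prime avoiding `g`.
    have hab := hj.natOrd_modEq hg (p i) n (hdvd i) (nonZeroDivisors.ne_zero ha)
      (nonZeroDivisors.ne_zero hb) fun q hgq => by
        have := h q
        rw [Finset.sum_eq_zero] at this
        · omega
        · intro i _
          rw [Finsupp.single_eq_of_ne (by rintro rfl; exact hgq (hgp i)), smul_zero]
    have hi := h (p i)
    rw [Finset.sum_eq_single i] at hi
    · simp only [Finsupp.single_eq_same, smul_eq_mul, mul_one] at hi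
      rw [hi]
      exact (Nat.modEq_iff_dvd.mp hab.symm)
    · intro l _ hl
      rw [Finsupp.single_eq_of_ne (fun h => hl (hinj hn h.symm)), smul_zero]
    · simp
  · intro hm
    refine Finset.sum_eq_zero fun i _ => ?_
    obtain ⟨c, hc⟩ := hm i
    have hz : (n : ℤ) • (p i).divisorClass = 0 := by
      obtain ⟨t, ht, htn, ht'⟩ := hnp i
      have : (n : ℤ) • (p i).divisorClass =
          (QuotientAddGroup.mk (Finsupp.single (p i) (n : ℤ)) : DivisorClassGroup R) := by
        rw [HeightOnePrime.divisorClass, ← QuotientAddGroup.mk'_apply, ← map_zsmul]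
        simp
      rw [this]
      refine WeilDivisor.mk_eq_zero_of_natOrd ht fun q => ?_
      by_cases hq : q = p i
      · rw [hq, htn, Finsupp.single_eq_same]
      · rw [Finsupp.single_eq_of_ne hq, ht' q hq, Nat.cast_zero]
    rw [hc, mul_comm, mul_zsmul, hz, zsmul_zero]

end ClassGroup

/-! ### Abelian groups presented by the relations `(nℤ)^ι` -/

section Presentation

variable {G : Type*} [AddCommGroup G] {ι : Type*} [Fintype ι] (x : ι → G) (n : ℕ)

/-- A group generated by a finite family whose only relations are the multiples of `n` is a power
of `ℤ/n`. -/
theorem nonempty_addEquiv_pi_zmod (hgen : AddSubgroup.closure (Set.range x) = ⊤)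
    (hrel : ∀ m : ι → ℤ, ∑ i, m i • x i = 0 ↔ ∀ i, (n : ℤ) ∣ m i) :
    Nonempty (G ≃+ (ι → ZMod n)) := by
  let φ : (ι → ℤ) →+ G :=
    { toFun := fun m => ∑ i, m i • x i
      map_zero' := by simp
      map_add' := fun m m' => by simp [add_zsmul, Finset.sum_add_distrib] }
  let χ : (ι → ℤ) →+ (ι → ZMod n) := (Int.castAddHom (ZMod n)).compLeft ι
  have hφ : Function.Surjective φ := by
    classical
    rw [← AddMonoidHom.range_eq_top, ← top_le_iff, ← hgen, AddSubgroup.closure_le]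
    rintro _ ⟨i, rfl⟩
    refine ⟨Pi.single i 1, ?_⟩
    change ∑ l, (Pi.single i 1 : ι → ℤ) l • x l = x i
    rw [Finset.sum_eq_single i] <;> simp +contextual
  have hχ : Function.Surjective χ := fun y => by
    choose m hm using fun i => ZMod.intCast_surjective (y i)
    exact ⟨m, funext hm⟩
  have hker : φ.ker = χ.ker := by
    ext m
    rw [AddMonoidHom.mem_ker, AddMonoidHom.mem_ker, funext_iff]
    refine (hrel m).trans (forall_congr' fun i => ?_)
    exact (ZMod.intCast_zmod_eq_zero_iff_dvd _ _).symm
  exact ⟨(QuotientAddGroup.quotientKerEquivOfSurjective φ hφ).symm.trans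
    ((QuotientAddGroup.quotientAddEquivOfEq hker).trans
      (QuotientAddGroup.quotientKerEquivOfSurjective χ hχ))⟩

/-- If `i ∉ s`, writing `x i` through the others gives a relation with coefficient `-1` at `i`,
which `n ≥ 2` does not divide. -/
theorem eq_univ_of_closure_image_eq_top (hn : 2 ≤ n)
    (hrel : ∀ m : ι → ℤ, ∑ i, m i • x i = 0 ↔ ∀ i, (n : ℤ) ∣ m i) (s : Set ι)
    (hs : AddSubgroup.closure (x '' s) = ⊤) : s = Set.univ := by
  classical
  rw [Set.eq_univ_iff_forall]
  intro i
  by_contra his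
  have hmem : ∀ y ∈ AddSubgroup.closure (x '' s), ∃ m : ι → ℤ, m i = 0 ∧ ∑ l, m l • x l = y := by
    intro y hy
    induction hy using AddSubgroup.closure_induction with
    | mem y hy =>
      obtain ⟨l, hl, rfl⟩ := hy
      refine ⟨Pi.single l 1, ?_, ?_⟩
      · rw [Pi.single_eq_of_ne]
        rintro rfl
        exact his hl
      · rw [Finset.sum_eq_single l] <;> simp +contextual
    | zero => exact ⟨0, rfl, by simp⟩
    | add y y' _ _ h h' =>
      obtain ⟨m, hm, rfl⟩ := h
      obtain ⟨m', hm', rfl⟩ := h'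
      exact ⟨m + m', by simp [hm, hm'], by simp [add_zsmul, Finset.sum_add_distrib]⟩
    | neg y _ h =>
      obtain ⟨m, hm, rfl⟩ := h
      exact ⟨-m, by simp [hm], by simp⟩
  obtain ⟨m, hm, hmx⟩ := hmem (x i) (hs ▸ AddSubgroup.mem_top _)
  have hzero : ∑ l, (m - Pi.single i 1 : ι → ℤ) l • x l = 0 := by
    simp only [Pi.sub_apply, sub_smul, Finset.sum_sub_distrib, hmx]
    rw [Finset.sum_eq_single i] <;> simp +contextual
  have := (hrel _).mp hzero i
  rw [Pi.sub_apply, hm, Pi.single_eq_same, zero_sub, dvd_neg] at this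
  have := Int.le_of_dvd one_pos this
  omega

end Presentation

/-! ### The hypersurface and its localization at `g` -/

namespace CyclicHypersurface

open MvPolynomial

variable {k : Type*} [Field k] {d : ℕ}

/-- The retraction of `k[x_0,…,x_d]` onto `k[x_1,…,x_d]` that sends `x_0` to `1`. -/
noncomputable def retraction (k : Type*) [Field k] (d : ℕ) :
    MvPolynomial (Fin (d + 1)) k →ₐ[k] MvPolynomial (Fin d) k :=
  aeval (Fin.cons 1 X)

@[simp]
theorem retraction_X_zero : retraction k d (X 0) = 1 := by simp [retraction]

@[simp]
theorem retraction_rename (h : MvPolynomial (Fin d) k) :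
    retraction k d (rename Fin.succ h) = h := by
  rw [retraction, aeval_rename]
  have : (Fin.cons 1 X : Fin (d + 1) → MvPolynomial (Fin d) k) ∘ Fin.succ = X := by
    ext i; simp
  rw [this, aeval_X_left, AlgHom.id_apply]

theorem rename_dvd_rename_iff {h h' : MvPolynomial (Fin d) k} :
    rename (Fin.succ (n := d)) h ∣ rename Fin.succ h' ↔ h ∣ h' := by
  refine ⟨fun H => ?_, map_dvd _⟩
  simpa using map_dvd (retraction k d) H

theorem not_rename_dvd_X_zero {h : MvPolynomial (Fin d) k} (hh : ¬ IsUnit h) :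
    ¬ rename (Fin.succ (n := d)) h ∣ X 0 := fun H =>
  hh (isUnit_of_dvd_one (by simpa using map_dvd (retraction k d) H))

/-- Singling out `x_0` as a polynomial variable turns `h` into a constant polynomial. -/
theorem prime_rename {h : MvPolynomial (Fin d) k} (hh : Prime h) :
    Prime (rename (Fin.succ (n := d)) h) := by
  rw [← MulEquiv.prime_iff (finSuccEquiv k d).toMulEquiv]
  have hC : (finSuccEquiv k d : _ →+* _).comp
      (rename Fin.succ : MvPolynomial (Fin d) k →ₐ[k] _).toRingHom = Polynomial.C := by
    refine MvPolynomial.ringHom_ext (fun c => ?_) (fun i => ?_)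
    · simp [finSuccEquiv_apply]
    · simp [finSuccEquiv_X_succ]
  have : (finSuccEquiv k d).toMulEquiv (rename Fin.succ h) = Polynomial.C h :=
    RingHom.congr_fun hC h
  rw [this, Polynomial.prime_C_iff]
  exact hh

/-- The defining polynomial `z^n - x_0 g`. -/
noncomputable abbrev equation (n : ℕ) (g : MvPolynomial (Fin d) k) :
    Polynomial (MvPolynomial (Fin (d + 1)) k) :=
  Polynomial.X ^ n - Polynomial.C (X 0 * rename Fin.succ g)

variable {n : ℕ} {g : MvPolynomial (Fin d) k}

theorem monic_equation (hn : 1 ≤ n) : (equation n g).Monic :=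
  Polynomial.monic_X_pow_sub_C _ (by omega)

/-- Setting `x_0 = 0` fixes `g` and kills multiples of `x_0`. -/
theorem not_X_zero_dvd_rename (hg : g ≠ 0) :
    ¬ (X 0 : MvPolynomial (Fin (d + 1)) k) ∣ rename Fin.succ g := by
  intro H
  have := map_dvd (aeval (Fin.cons 0 X) :
    MvPolynomial (Fin (d + 1)) k →ₐ[k] MvPolynomial (Fin d) k) H
  rw [aeval_rename, show (Fin.cons 0 X : Fin (d + 1) → MvPolynomial (Fin d) k) ∘ Fin.succ = X by
    ext i; simp, aeval_X_left, AlgHom.id_apply, aeval_X, Fin.cons_zero, zero_dvd_iff] at this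
  exact hg this

/-- Eisenstein at `(x_0)`: the constant term `-x_0 g` is divisible by `x_0` but not by `x_0²`. -/
theorem prime_equation (hn : 1 ≤ n) (hg : g ≠ 0) : Prime (equation n g) := by
  have hX : Prime (X 0 : MvPolynomial (Fin (d + 1)) k) := X_prime
  have hdeg : (equation n g).degree = n := Polynomial.degree_X_pow_sub_C (by omega) _
  refine Irreducible.prime (Polynomial.irreducible_of_eisenstein_criterion
    (P := Ideal.span {X 0}) ((Ideal.span_singleton_prime hX.ne_zero).mpr hX) ?_ ?_ ?_ ?_
    (monic_equation hn).isPrimitive)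
  · rw [(monic_equation hn).leadingCoeff, Ideal.mem_span_singleton]
    exact hX.not_dvd_one
  · intro m hm
    rw [hdeg, Nat.cast_lt] at hm
    rw [Polynomial.coeff_sub, Polynomial.coeff_X_pow, if_neg hm.ne, zero_sub, neg_mem_iff,
      Polynomial.coeff_C]
    split_ifs
    · exact Ideal.mul_mem_right _ _ (Ideal.mem_span_singleton_self _)
    · exact zero_mem _
  · rw [hdeg]
    exact_mod_cast hn
  · rw [Polynomial.coeff_sub, Polynomial.coeff_X_pow, if_neg (by omega), zero_sub, neg_mem_iff,
      Polynomial.coeff_C_zero, Ideal.span_singleton_pow, Ideal.mem_span_singleton, sq,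
      mul_dvd_mul_iff_left hX.ne_zero]
    exact not_X_zero_dvd_rename hg

theorem isDomain (hn : 1 ≤ n) (hg : g ≠ 0) : IsDomain (CyclicHypersurface n g) :=
  AdjoinRoot.isDomain_of_prime (prime_equation hn hg)

instance : IsNoetherianRing (CyclicHypersurface n g) :=
  inferInstanceAs (IsNoetherianRing (_ ⧸ _))

/-- The image of `x_0`. -/
noncomputable def x₀ (n : ℕ) (g : MvPolynomial (Fin d) k) : CyclicHypersurface n g :=
  AdjoinRoot.of _ (X 0)

theorem z_pow : z n g ^ n = x₀ n g * ofPoly n g g := by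
  have h := AdjoinRoot.mk_self (f := equation n g)
  rw [map_sub (AdjoinRoot.mk _), map_pow (AdjoinRoot.mk _), AdjoinRoot.mk_X, AdjoinRoot.mk_C,
    map_mul (AdjoinRoot.of _), sub_eq_zero] at h
  exact h

theorem ofPoly_mul (a b : MvPolynomial (Fin d) k) :
    ofPoly n g (a * b) = ofPoly n g a * ofPoly n g b := by
  rw [ofPoly, map_mul (rename Fin.succ), map_mul (AdjoinRoot.of _)]
  rfl

/-- The inclusion of `k[x_1,…,x_d][z]`. -/
noncomputable def incl (n : ℕ) (g : MvPolynomial (Fin d) k) :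
    Polynomial (MvPolynomial (Fin d) k) →+* CyclicHypersurface n g :=
  Polynomial.eval₂RingHom ((AdjoinRoot.of (equation n g)).comp
    (rename Fin.succ : MvPolynomial (Fin d) k →ₐ[k] _).toRingHom) (z n g)

@[simp]
theorem incl_C (h : MvPolynomial (Fin d) k) : incl n g (Polynomial.C h) = ofPoly n g h := by
  simp [incl, ofPoly]

@[simp]
theorem incl_X : incl n g Polynomial.X = z n g := by
  simp [incl]

/-- Sending `x_0` to `z^n/g` respects the equation. This yields the injectivity of `incl`. -/
theorem exists_leftInverse_incl (hg : g ≠ 0) :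
    ∃ θ : CyclicHypersurface n g →+* FractionRing (Polynomial (MvPolynomial (Fin d) k)),
      θ.comp (incl n g) = algebraMap _ _ := by
  let K := FractionRing (Polynomial (MvPolynomial (Fin d) k))
  let a : Polynomial (MvPolynomial (Fin d) k) →+* K := algebraMap _ _
  have ha : a (Polynomial.C g) ≠ 0 := by
    have : Function.Injective a := IsFractionRing.injective _ _
    simpa using this.ne (Polynomial.C_ne_zero.mpr hg)
  let τ : MvPolynomial (Fin (d + 1)) k →+* K :=
    eval₂Hom (a.comp (Polynomial.C.comp C))
      (Fin.cons (a Polynomial.X ^ n / a (Polynomial.C g)) fun i => a (Polynomial.C (X i)))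
  have hτ : τ.comp (rename Fin.succ : MvPolynomial (Fin d) k →ₐ[k] _).toRingHom =
      a.comp Polynomial.C := by
    refine MvPolynomial.ringHom_ext (fun c => ?_) (fun i => ?_) <;> simp [τ]
  have hτ' : ∀ h, τ (rename Fin.succ h) = a (Polynomial.C h) := fun h => RingHom.congr_fun hτ h
  have hroot : (equation n g).eval₂ τ (a Polynomial.X) = 0 := by
    have h0 : τ (X 0) = a Polynomial.X ^ n / a (Polynomial.C g) := by simp [τ]
    rw [equation, Polynomial.eval₂_sub, Polynomial.eval₂_X_pow, Polynomial.eval₂_C, map_mul, h0,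
      hτ', div_mul_cancel₀ _ ha, sub_self]
  refine ⟨AdjoinRoot.lift τ _ hroot, Polynomial.ringHom_ext (fun h => ?_) ?_⟩
  · rw [RingHom.comp_apply, incl_C, ofPoly, AdjoinRoot.lift_of, hτ']
  · rw [RingHom.comp_apply, incl_X, z, AdjoinRoot.lift_root]

/-- The relation `g x_0 = z^n` clears `x_0`; the other generators already lie in the image, and the
property passes to sums and products. -/
theorem isIsoAway_incl (hg : g ≠ 0) : IsIsoAway (incl n g) (Polynomial.C g) := by
  refine ⟨?_, ?_⟩
  · obtain ⟨θ, hθ⟩ := exists_leftInverse_incl (n := n) hg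
    refine Function.Injective.of_comp (f := θ) ?_
    rw [← RingHom.coe_comp, hθ]
    exact IsFractionRing.injective _ _
  · have hadd : ∀ a b : CyclicHypersurface n g,
        (∃ N c, incl n g (Polynomial.C g) ^ N * a = incl n g c) →
        (∃ N c, incl n g (Polynomial.C g) ^ N * b = incl n g c) →
        ∃ N c, incl n g (Polynomial.C g) ^ N * (a + b) = incl n g c := by
      rintro a b ⟨N, c, h⟩ ⟨M, e, h'⟩
      refine ⟨N + M, Polynomial.C g ^ M * c + Polynomial.C g ^ N * e, ?_⟩
      simp only [map_add, map_mul, map_pow]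
      linear_combination incl n g (Polynomial.C g) ^ M * h + incl n g (Polynomial.C g) ^ N * h'
    have hmul : ∀ a b : CyclicHypersurface n g,
        (∃ N c, incl n g (Polynomial.C g) ^ N * a = incl n g c) →
        (∃ N c, incl n g (Polynomial.C g) ^ N * b = incl n g c) →
        ∃ N c, incl n g (Polynomial.C g) ^ N * (a * b) = incl n g c := by
      rintro a b ⟨N, c, h⟩ ⟨M, e, h'⟩
      refine ⟨N + M, c * e, ?_⟩
      simp only [map_mul]
      linear_combination incl n g (Polynomial.C g) ^ M * b * h + incl n g c * h'
    have hof : ∀ F : MvPolynomial (Fin (d + 1)) k,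
        ∃ N c, incl n g (Polynomial.C g) ^ N * AdjoinRoot.of (equation n g) F = incl n g c := by
      intro F
      induction F using MvPolynomial.induction_on with
      | C c =>
        refine ⟨0, Polynomial.C (C c), ?_⟩
        rw [pow_zero, one_mul, incl_C, ofPoly, rename_C]
      | add F G hF hG => rw [map_add (AdjoinRoot.of _)]; exact hadd _ _ hF hG
      | mul_X F i hF =>
        rw [map_mul (AdjoinRoot.of _)]
        refine hmul _ _ hF ?_
        refine Fin.cases ?_ (fun i => ?_) i
        · refine ⟨1, Polynomial.X ^ n, ?_⟩
          rw [pow_one, incl_C, map_pow, incl_X, z_pow, mul_comm, x₀]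
        · refine ⟨0, Polynomial.C (X i), ?_⟩
          rw [pow_zero, one_mul, incl_C, ofPoly, rename_X]
    have hz : ∃ N c, incl n g (Polynomial.C g) ^ N * z n g = incl n g c :=
      ⟨0, Polynomial.X, by simp⟩
    intro a
    induction a using AdjoinRoot.induction_on with
    | ih p =>
      induction p using Polynomial.induction_on with
      | C F => exact hof F
      | add p q hp hq => rw [map_add (AdjoinRoot.mk _)]; exact hadd _ _ hp hq
      | monomial m F h =>
        rw [pow_succ, ← mul_assoc, map_mul (AdjoinRoot.mk _)]
        exact hmul _ _ h hz

/-! ### The primes `(z, h)` -/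

/-- The ideal `(z, h)`. -/
noncomputable def primeOver (n : ℕ) (g h : MvPolynomial (Fin d) k) :
    Ideal (CyclicHypersurface n g) :=
  Ideal.span {z n g, ofPoly n g h}

section

variable {h : MvPolynomial (Fin d) k}

/-- For `h ∣ g` the equation becomes `0 = 0` modulo `z` and `h`, so `R/(z, h)` is
`k[x_0,…,x_d]/(h)`. -/
theorem exists_ker_eq_primeOver (hn : 1 ≤ n) (hhg : h ∣ g) :
    ∃ π : CyclicHypersurface n g →+*
        MvPolynomial (Fin (d + 1)) k ⧸ Ideal.span {rename (Fin.succ (n := d)) h},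
      RingHom.ker π = primeOver n g h ∧
      ∀ F, π (AdjoinRoot.of _ F) = Ideal.Quotient.mk _ F := by
  set I : Ideal (MvPolynomial (Fin (d + 1)) k) := Ideal.span {rename Fin.succ h} with hI
  have hroot : (equation n g).eval₂ (Ideal.Quotient.mk I) 0 = 0 := by
    rw [equation, Polynomial.eval₂_sub, Polynomial.eval₂_X_pow, Polynomial.eval₂_C,
      zero_pow (by omega), zero_sub, neg_eq_zero, Ideal.Quotient.eq_zero_iff_mem,
      Ideal.mem_span_singleton]
    exact (map_dvd (rename Fin.succ) hhg).mul_left _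
  refine ⟨AdjoinRoot.lift _ _ hroot, le_antisymm ?_ ?_, fun F => AdjoinRoot.lift_of hroot⟩
  · intro a ha
    induction a using AdjoinRoot.induction_on with
    | ih p =>
      -- Modulo `z` only the constant coefficient of `p` survives.
      rw [RingHom.mem_ker, AdjoinRoot.lift_mk, ← Polynomial.divX_mul_X_add p,
        Polynomial.eval₂_add, Polynomial.eval₂_mul, Polynomial.eval₂_X, mul_zero, zero_add,
        Polynomial.eval₂_C, Ideal.Quotient.eq_zero_iff_mem, Ideal.mem_span_singleton] at ha
      obtain ⟨c, hc⟩ := ha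
      rw [← Polynomial.divX_mul_X_add p, map_add (AdjoinRoot.mk _), map_mul (AdjoinRoot.mk _),
        AdjoinRoot.mk_X, AdjoinRoot.mk_C, hc, map_mul (AdjoinRoot.of _)]
      refine add_mem (Ideal.mul_mem_left _ _ (Ideal.subset_span ?_))
        (Ideal.mul_mem_right _ _ (Ideal.subset_span ?_))
      · exact Or.inl rfl
      · exact Or.inr rfl
  · rw [primeOver, Ideal.span_le]
    rintro _ (rfl | rfl)
    · exact AdjoinRoot.lift_root hroot
    · refine (AdjoinRoot.lift_of hroot).trans ?_
      rw [Ideal.Quotient.eq_zero_iff_mem]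
      exact Ideal.mem_span_singleton_self _

theorem of_mem_primeOver_iff (hn : 1 ≤ n) (hhg : h ∣ g) {F : MvPolynomial (Fin (d + 1)) k} :
    AdjoinRoot.of _ F ∈ primeOver n g h ↔ rename Fin.succ h ∣ F := by
  obtain ⟨π, hker, hπ⟩ := exists_ker_eq_primeOver hn hhg
  rw [← hker, RingHom.mem_ker, hπ, Ideal.Quotient.eq_zero_iff_mem, Ideal.mem_span_singleton]

theorem ofPoly_mem_primeOver_iff (hn : 1 ≤ n) (hhg : h ∣ g) {h' : MvPolynomial (Fin d) k} :
    ofPoly n g h' ∈ primeOver n g h ↔ h ∣ h' := by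
  rw [ofPoly, of_mem_primeOver_iff hn hhg, rename_dvd_rename_iff]

theorem x₀_notMem_primeOver (hn : 1 ≤ n) (hh : Prime h) (hhg : h ∣ g) :
    x₀ n g ∉ primeOver n g h := by
  rw [x₀, of_mem_primeOver_iff hn hhg]
  exact not_rename_dvd_X_zero hh.not_isUnit

theorem isPrime_primeOver (hn : 1 ≤ n) (hh : Prime h) (hhg : h ∣ g) :
    (primeOver n g h).IsPrime := by
  obtain ⟨π, hker, -⟩ := exists_ker_eq_primeOver hn hhg
  have hp := prime_rename hh
  have := (Ideal.span_singleton_prime hp.ne_zero).mpr hp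
  rw [← hker]
  exact RingHom.ker_isPrime π

theorem z_mem_primeOver : z n g ∈ primeOver n g h := Ideal.subset_span (Or.inl rfl)

theorem ofPoly_mem_primeOver : ofPoly n g h ∈ primeOver n g h := Ideal.subset_span (Or.inr rfl)

/-- From `h ∈ q` follows `z^n = x_0 g ∈ q`, hence `z ∈ q`. -/
theorem primeOver_le (hhg : h ∣ g) {q : Ideal (CyclicHypersurface n g)} (hq : q.IsPrime)
    (hmem : ofPoly n g h ∈ q) : primeOver n g h ≤ q := by
  rw [primeOver, Ideal.span_le]
  rintro _ (rfl | rfl)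
  · refine hq.mem_of_pow_mem n ?_
    obtain ⟨c, rfl⟩ := hhg
    rw [z_pow, ofPoly_mul]
    exact Ideal.mul_mem_left _ _ (Ideal.mul_mem_right _ _ hmem)
  · exact hmem

theorem ofPoly_ne_zero (hg : g ≠ 0) (hh0 : h ≠ 0) : ofPoly n g h ≠ 0 := by
  rw [← incl_C]
  exact (isIsoAway_incl hg).map_ne_zero (Polynomial.C_ne_zero.mpr hh0)

theorem z_ne_zero (hg : g ≠ 0) : z n g ≠ 0 := by
  rw [← incl_X]
  exact (isIsoAway_incl hg).map_ne_zero Polynomial.X_ne_zero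

theorem height_primeOver (hn : 1 ≤ n) (hh : Prime h) (hhg : h ∣ g) (hg : g ≠ 0) :
    (primeOver n g h).height = 1 := by
  have := isDomain hn hg
  have := isPrime_primeOver hn hh hhg
  exact Ideal.height_eq_one_of_minimal_over_singleton (ofPoly_ne_zero hg hh.ne_zero)
    ofPoly_mem_primeOver fun q hq hmem _ => primeOver_le hhg hq hmem

end

/-! ### Squarefreeness of `g` and the order of `h` along `(z, h)` -/

/-- If the hypersurface is normal and `n ≥ 2`, then `g` is squarefree. -/
theorem not_sq_dvd_of_isIntegrallyClosed (hn : 2 ≤ n) (hg : g ≠ 0)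
    [IsIntegrallyClosed (CyclicHypersurface n g)] {h : MvPolynomial (Fin d) k}
    (hh : ¬ IsUnit h) : ¬ h ^ 2 ∣ g := by
  rintro ⟨w, hw⟩
  have := isDomain (n := n) (by omega) hg
  have hh0 : h ≠ 0 := by
    rintro rfl
    exact hg (by simpa using hw)
  let K := FractionRing (CyclicHypersurface n g)
  let a : CyclicHypersurface n g →+* K := algebraMap _ _
  have hinj : Function.Injective a := IsFractionRing.injective _ _
  have ht : a (ofPoly n g h) ≠ 0 := by simpa using hinj.ne (ofPoly_ne_zero hg hh0)
  have hfac : ofPoly n g g = ofPoly n g h ^ 2 * ofPoly n g w := by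
    rw [sq, ← ofPoly_mul, ← ofPoly_mul, ← sq, ← hw]
  obtain ⟨m, rfl⟩ : ∃ m, n = m + 2 := ⟨n - 2, by omega⟩
  -- With `g = h² w` and `n = m + 2`, the `n`-th power of `z^(n-1)/h` lies in `R`, so normality puts
  -- this fraction in `R`.
  have hpow : (a (z _ g) ^ (m + 1) / a (ofPoly _ g h)) ^ (m + 2) =
      a (x₀ _ g ^ (m + 1) * ofPoly _ g w ^ (m + 1) * ofPoly _ g h ^ m) := by
    have h1 : a (z (m + 2) g) ^ (m + 2) =
        a (x₀ _ g) * (a (ofPoly _ g h) ^ 2 * a (ofPoly _ g w)) := by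
      rw [← map_pow, z_pow, hfac]; simp
    rw [div_pow, ← pow_mul, mul_comm (m + 1), pow_mul, h1, div_eq_iff (pow_ne_zero _ ht)]
    simp only [map_mul, map_pow]
    ring
  obtain ⟨y, hy⟩ := IsIntegrallyClosed.exists_algebraMap_eq_of_isIntegral_pow
    (R := CyclicHypersurface (m + 2) g) (K := K) (n := m + 2) (by omega)
    (hpow ▸ isIntegral_algebraMap)
  have hz : z (m + 2) g ^ (m + 1) = ofPoly _ g h * y := by
    apply hinj
    rw [map_mul a, show a y = _ from hy, map_pow a]
    exact (mul_div_cancel₀ _ ht).symm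
  obtain ⟨Y, rfl⟩ := AdjoinRoot.mk_surjective y
  have hmk : AdjoinRoot.mk (equation (m + 2) g) (Polynomial.X ^ (m + 1)) =
      AdjoinRoot.mk (equation (m + 2) g) (rename Fin.succ h • Y) := by
    rw [Polynomial.smul_eq_C_mul, map_mul (AdjoinRoot.mk _), map_pow (AdjoinRoot.mk _),
      AdjoinRoot.mk_X, AdjoinRoot.mk_C]
    exact hz
  have hmonic := monic_equation (n := m + 2) (g := g) (by omega)
  have hdeg : (Polynomial.X ^ (m + 1) : Polynomial (MvPolynomial (Fin (d + 1)) k)).degree <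
      (equation (m + 2) g).degree := by
    rw [Polynomial.degree_X_pow, equation, Polynomial.degree_X_pow_sub_C (by omega)]
    exact_mod_cast Nat.lt_succ_self _
  rw [AdjoinRoot.mk_eq_mk] at hmk
  -- Now `z^(n-1) ∈ hR`. Comparing coefficients of `z^(n-1)` in remainders modulo the monic equation
  -- gives `h ∣ 1`.
  have hmod := (Polynomial.modByMonic_eq_of_dvd_sub hmonic hmk)
  rw [(Polynomial.modByMonic_eq_self_iff hmonic).mpr hdeg, Polynomial.smul_modByMonic] at hmod
  have hcoeff := congrArg (fun p => Polynomial.coeff p (m + 1)) hmod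
  simp only [Polynomial.coeff_X_pow_self, Polynomial.coeff_smul, smul_eq_mul] at hcoeff
  have hdvd : rename (Fin.succ (n := d)) h ∣ rename Fin.succ 1 := by
    rw [map_one]
    exact ⟨_, hcoeff⟩
  exact hh (isUnit_of_dvd_one (rename_dvd_rename_iff.mp hdvd))

/-- The order of `h` along `(z, h)` is `n`, if `h` is a simple factor of `g` or `n = 1`. -/
theorem natOrd_ofPoly_self (hn : 1 ≤ n) (hg : g ≠ 0) {h : MvPolynomial (Fin d) k} (hh : Prime h)
    (hhg : h ∣ g) (hsq : n ≠ 1 → ¬ h ^ 2 ∣ g) {p : HeightOnePrime (CyclicHypersurface n g)}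
    (hp : p.asIdeal = primeOver n g h) : p.natOrd (ofPoly n g h) = n := by
  have := isDomain hn hg
  have hh0 := ofPoly_ne_zero (n := n) hg hh.ne_zero
  obtain ⟨w, hw⟩ := hhg
  have hz : z n g ^ n = x₀ n g * (ofPoly n g h * ofPoly n g w) := by
    rw [z_pow, ← ofPoly_mul, ← hw]
  -- If `n = 1`, then `z` is a multiple of `h`, so `h` alone generates `(z, h)`, even when it is a
  -- repeated factor.
  by_cases h1 : n = 1
  · have hz1 : z n g = x₀ n g * (ofPoly n g h * ofPoly n g w) := by
      rw [← hz, show z n g ^ n = z n g ^ 1 from congrArg (z n g ^ ·) h1, pow_one]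
    have hone : p.natOrd (ofPoly n g h) = 1 := by
      refine p.natOrd_eq_one (hp ▸ ofPoly_mem_primeOver) fun b hb => ?_
      rw [hp, primeOver, Ideal.mem_span_pair] at hb
      obtain ⟨u, v, rfl⟩ := hb
      refine ⟨1, fun h => p.isPrime.ne_top ((Ideal.eq_top_iff_one _).mpr h),
        u * x₀ n g * ofPoly n g w + v, ?_⟩
      rw [one_mul]
      linear_combination u * hz1
    rw [hone, h1]
  -- Here `h ∤ w`, so `x_0 w` is a unit at `p`. From `z^n = h · x_0 w`, `z` is a uniformizer and `h`
  -- has order `n`.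
  · have hu : x₀ n g * ofPoly n g w ∉ p.asIdeal := by
      intro hmem
      rcases p.isPrime.mem_or_mem hmem with hmem | hmem
      · rw [hp] at hmem
        exact x₀_notMem_primeOver hn hh ⟨w, hw⟩ hmem
      · rw [hp, ofPoly_mem_primeOver_iff hn ⟨w, hw⟩] at hmem
        obtain ⟨v, rfl⟩ := hmem
        exact hsq h1 ⟨v, by rw [hw]; ring⟩
    have hu0 : x₀ n g * ofPoly n g w ≠ 0 := fun h => hu (h ▸ zero_mem _)
    have hzn : z n g ^ n = ofPoly n g h * (x₀ n g * ofPoly n g w) := by rw [hz]; ring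
    have hzone : p.natOrd (z n g) = 1 := by
      refine p.natOrd_eq_one (hp ▸ z_mem_primeOver) fun b hb => ?_
      rw [hp, primeOver, Ideal.mem_span_pair] at hb
      obtain ⟨u, v, rfl⟩ := hb
      refine ⟨_, hu, x₀ n g * ofPoly n g w * u + v * z n g ^ (n - 1), ?_⟩
      have hsucc : z n g ^ n = z n g * z n g ^ (n - 1) := by
        rw [← pow_succ', Nat.sub_add_cancel hn]
      linear_combination v * hsucc - v * hzn
    have := p.natOrd_pow (z_ne_zero hg) n
    rw [hzn, p.natOrd_mul hh0 hu0, (p.natOrd_eq_zero_iff hu0).mpr hu, hzone] at this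
    simpa using this

end CyclicHypersurface

/-! ### The class group of the hypersurface -/

open CyclicHypersurface

theorem corollary3p4 {k : Type*} [Field k] (d n r : ℕ) (hn : 1 ≤ n)
    (g : MvPolynomial (Fin d) k) (hg : IsWeightedHomogeneousPoly g)
    (h : Fin r → MvPolynomial (Fin d) k) (hirr : ∀ i, Irreducible (h i)) (hprod : g = ∏ i, h i)
    (hnormal : IsIntegrallyClosed (CyclicHypersurface n g)) :
    Nonempty (DivisorClassGroup (CyclicHypersurface n g) ≃+ (Fin r → ZMod n)) ∧
    ∃ p : Fin r → HeightOnePrime (CyclicHypersurface n g),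
      (∀ i, (p i).asIdeal =
        Ideal.span {CyclicHypersurface.z n g, CyclicHypersurface.ofPoly n g (h i)}) ∧
      AddSubgroup.closure (Set.range fun i => (p i).divisorClass) = ⊤ ∧
      (2 ≤ n → ∀ s : Set (Fin r),
        AddSubgroup.closure ((fun i => (p i).divisorClass) '' s) = ⊤ → s = Set.univ) := by
  have hprime : ∀ i, Prime (h i) := fun i => (hirr i).prime
  have hg0 : g ≠ 0 := hprod ▸ Finset.prod_ne_zero_iff.mpr fun i _ => (hprime i).ne_zero
  have hdvd : ∀ i, h i ∣ g := fun i => hprod ▸ Finset.dvd_prod_of_mem h (Finset.mem_univ i)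
  have hsq : n ≠ 1 → ∀ i, ¬ h i ^ 2 ∣ g := fun hn1 i =>
    not_sq_dvd_of_isIntegrallyClosed (n := n) (by omega) hg0 (hirr i).not_isUnit
  have := isDomain hn hg0
  have hj := isIsoAway_incl (n := n) hg0
  let p : Fin r → HeightOnePrime (CyclicHypersurface n g) := fun i =>
    ⟨primeOver n g (h i), isPrime_primeOver hn (hprime i) (hdvd i),
      height_primeOver hn (hprime i) (hdvd i) hg0⟩
  have heq : ∀ (q : HeightOnePrime (CyclicHypersurface n g)) (i : Fin r),
      ofPoly n g (h i) ∈ q.asIdeal → q = p i := fun q i hi =>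
    HeightOnePrime.ext_asIdeal (q.eq_of_le (p i).isPrime (p i).asIdeal_ne_bot
      (primeOver_le (hdvd i) q.isPrime hi)).symm
  have hcontains : ∀ q : HeightOnePrime (CyclicHypersurface n g),
      incl n g (Polynomial.C g) ∈ q.asIdeal → ∃ i, q = p i := by
    intro q hq
    have hq' : ∏ i, incl n g (Polynomial.C (h i)) ∈ q.asIdeal := by
      rwa [← map_prod (incl n g), ← map_prod Polynomial.C, ← hprod]
    have := q.isPrime
    obtain ⟨i, -, hi⟩ := (Ideal.IsPrime.prod_mem_iff).mp hq'
    exact ⟨i, heq q i (incl_C (h i) ▸ hi)⟩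
  have hmem : ∀ i, incl n g (Polynomial.C g) ∈ (p i).asIdeal := fun i => by
    rw [incl_C]
    exact (ofPoly_mem_primeOver_iff hn (hdvd i)).mpr (hdvd i)
  have hself : ∀ i, (p i).natOrd (ofPoly n g (h i)) = n := fun i =>
    natOrd_ofPoly_self hn hg0 (hprime i) (hdvd i) (fun hn1 => hsq hn1 i) rfl
  have hother : ∀ i q, q ≠ p i → q.natOrd (ofPoly n g (h i)) = 0 := fun i q hq => by
    rw [q.natOrd_eq_zero_iff (ofPoly_ne_zero hg0 (hprime i).ne_zero)]
    exact fun hi => hq (heq q i hi)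
  -- Prime factors of `g` in `B` are associates of the `h l`, whose order along `p i` is `n` or `0`.
  have hfactor : ∀ i f, Prime f → f ∣ Polynomial.C g → n ∣ (p i).natOrd (incl n g f) := by
    intro i f hf hfg
    rw [hprod, map_prod] at hfg
    obtain ⟨l, -, hl⟩ := (hf.dvd_finsetProd_iff _).mp hfg
    obtain ⟨u, hu⟩ := hf.associated_of_dvd (Polynomial.prime_C_iff.mpr (hprime l)) hl
    have hord : (p i).natOrd (incl n g f) = (p i).natOrd (ofPoly n g (h l)) := by
      rw [← incl_C, ← hu, map_mul (incl n g), (p i).natOrd_mul (hj.map_ne_zero hf.ne_zero)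
        (u.isUnit.map (incl n g)).ne_zero, IsIsoAway.natOrd_map_of_isUnit (p i) u.isUnit, add_zero]
    rw [hord]
    by_cases hil : p i = p l
    · rw [hil, hself l]
    · rw [hother l _ hil]
      exact dvd_zero n
  -- A coincidence `p i = p l` with `i ≠ l` gives `h l ∣ h i`, hence `(h l)² ∣ g`.
  have hinj : n ≠ 1 → Function.Injective p := by
    intro hn1 i l hil
    by_contra hne
    have hli : h l ∣ h i := by
      rw [← ofPoly_mem_primeOver_iff hn (hdvd l)]
      have : primeOver n g (h i) = primeOver n g (h l) := congrArg HeightOnePrime.asIdeal hil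
      exact this ▸ ofPoly_mem_primeOver
    refine hsq hn1 l ?_
    rw [hprod, ← Finset.mul_prod_erase _ _ (Finset.mem_univ i), sq]
    exact mul_dvd_mul hli
      (Finset.dvd_prod_of_mem h (Finset.mem_erase.mpr ⟨Ne.symm hne, Finset.mem_univ l⟩))
  have hgen := hj.closure_divisorClass_eq_top p hcontains
  have hrel := hj.sum_zsmul_divisorClass_eq_zero_iff (Polynomial.C_ne_zero.mpr hg0) p n hmem
    hfactor (fun i => ⟨_, ofPoly_ne_zero hg0 (hprime i).ne_zero, hself i, hother i⟩) hinj
  exact ⟨nonempty_addEquiv_pi_zmod _ n hgen hrel, p, fun i => rfl, hgen,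
    fun hn2 s hs => eq_univ_of_closure_image_eq_top _ n hn2 hrel s hs⟩
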